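/- **Setting** ($\hbar=1$). The system $\mathcal S$ has a finite-dimensional Hilbert space with Hamiltonian $\hat H_S=\sum_i \epsilon_i |\epsilon_i\rangle\langle\epsilon_i|$, where $(|\epsilon_i\rangle)_i$ is an orthonormal basis. The quantum weight $\mathcal W$ has Hilbert space $L^2(\mathbb R)$, its Hamiltonian $\hat H_W$ is multiplication by the energy variable $E$, and the time operator is $\hat\Delta_W=-i\,\frac{d}{dE}$, so that $[\hat H_W,\hat\Delta_W]=i$ and $(e^{-i a\hat\Delta_W}\psi)(E)=\psi(E-a)$. The (generalized) eigenstates of $\hat\Delta_W$, $\langle E|t\rangle=(2\pi)^{-1/2}e^{itE}$, are called time states. For a density operator $\hat\rho$ of the weight let $f(E)=\langle E|\hat\rho|E\rangle$ and $g(t)=\langle t|\hat\rho|t\rangle$ be the probability densities (defined almost everywhere) of energy and of time states, and let $\sigma_E\in[0,\infty]$ be the standard deviation of the distribution with density $f$ (equal to $\infty$ if the second moment is infinite). A *work extraction protocol* is a unitary $\hat U$ on the composite Hilbert space with $[\hat U,\hat H_S+\hat H_W]=0$ and $[\hat U,\hat\Delta_W]=0$, in the sense that $\hat U$ commutes with the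 unitary groups generated by $\hat H_S+\hat H_W$ and by $\hat\Delta_W$. It acts on an initial product state $\hat\rho_S\otimes\hat\rho_W$ of density operators, so that the final state of the weight is $\hat\rho_W'=\mathrm{Tr}_S[\hat U(\hat\rho_S\otimes\hat\rho_W)\hat U^\dagger]$. Let $g$ and $\sigma_E^{(i)}$ be the time-state density and the energy standard deviation of $\hat\rho_W$, let $g'$ and $\sigma_E^{(f)}$ be those of $\hat\rho_W'$, and let $$\gamma(\omega)=\int_{\mathbb R} g(t)\,e^{i\omega t}\,dt ,\qquad \omega\in\mathbb R,$$ be the characteristic function of $g$. **Theorem.** For all density operators $\hat\rho_S$, $\hat\rho_W$ and every work extraction protocol $\hat U$: 1. $\gamma$ is the dumping function of the ergotropy decoherence: with $\hat S=e^{-i\hat H_S\otimes\hat\Delta_W}$, the control-marginal state $\hat\sigma_S=\mathrm{Tr}_W[\hat S(\hat\rho_S\otimes\hat\rho_W)\hat S^\dagger]$ satisfies $\langle\epsilon_i|\hat\sigma_S|\epsilon_j\rangle=\gamma(\epsilon_j-\epsilon_i)\,\langle\epsilon_i|\hat\rho_S|\epsilon_j\rangle$ for all $i,j$. 2. The time-state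 distribution is invariant under the protocol: $g'(t)=g(t)$ for almost every $t$. 3. The initial and the final energy standard deviations of the weight satisfy $$\sigma_E^{(i)}\ \ge\ \frac1\pi\,\sup_{\omega>0}\ \omega\,|\gamma(\omega)|\qquad\text{and}\qquad \sigma_E^{(f)}\ \ge\ \frac1\pi\,\sup_{\omega>0}\ \omega\,|\gamma(\omega)| ,$$ where the supremum is taken in $[0,\infty]$. -/

import Mathlib

open MeasureTheory ProbabilityTheory
open scoped ENNReal InnerProductSpace FourierTransform ComplexOrder

noncomputable section

namespace QuantumWeight

/-! ### Traces and density operators on a Hilbert space -/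

section Trace

variable (H : Type*) [NormedAddCommGroup H] [InnerProductSpace ℂ H] [CompleteSpace H]

/-- The index set of a fixed orthonormal basis of `H`. -/
def BasisIndex : Set H := (exists_hilbertBasis ℂ H).choose

/-- A fixed orthonormal (Hilbert) basis of `H`, used to evaluate traces. -/
def stdBasis : HilbertBasis (BasisIndex H) ℂ H :=
  (exists_hilbertBasis ℂ H).choose_spec.choose

variable {H}

/-- The trace `∑ₖ ⟨bₖ, A bₖ⟩`. For a trace-class `A` it does not depend on the basis. -/
def tr (A : H →L[ℂ] H) : ℂ := ∑' k, ⟪stdBasis H k, A (stdBasis H k)⟫_ℂ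

/-- A density operator: a positive operator which is trace class with trace one. -/
def IsDensityOperator (ρ : H →L[ℂ] H) : Prop :=
  ρ.IsPositive ∧ HasSum (fun k => ⟪stdBasis H k, ρ (stdBasis H k)⟫_ℂ) 1

/-- The positive square root `√ρ` of a positive operator. -/
def opSqrt (ρ : H →L[ℂ] H) : H →L[ℂ] H := CFC.sqrt ρ

end Trace

/-! ### The weight -/

/-- The Hilbert space `L²(ℝ)` of the weight in the energy representation: `ψ(E) = ⟨E|ψ⟩`, and the
weight Hamiltonian `H_W` is the multiplication by `E`. -/
abbrev Weight : Type := Lp ℂ 2 (volume : Measure ℝ)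

/-- The displacement operator `Γ_a = exp(-i a Δ_W)`, `(Γ_a ψ)(E) = ψ(E - a)`. Its generator, the time
operator, is `Δ_W = -i d/dE`, which satisfies `[H_W, Δ_W] = i`. -/
def displacement (a : ℝ) : Weight →L[ℂ] Weight :=
  (Lp.compMeasurePreservingₗᵢ ℂ (fun E : ℝ => E - a)
    (measurePreserving_sub_right volume a)).toContinuousLinearMap

lemma memLp_phase (s : ℝ) :
    MemLp (fun E : ℝ => Complex.exp (-(s * E : ℝ) * Complex.I)) ∞ volume := by
  refine memLp_top_of_bound (by fun_prop) 1 (Filter.Eventually.of_forall fun E => ?_)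
  have := Complex.norm_exp_ofReal_mul_I (-(s * E))
  push_cast at this ⊢
  exact this.le

/-- The free evolution `exp(-i s H_W)` of the weight, `ψ(E) ↦ exp(-i s E) ψ(E)`. -/
def weightEvolution (s : ℝ) : Weight →L[ℂ] Weight :=
  (ContinuousLinearMap.mul ℂ ℂ).holderL volume ∞ 2 2 ((memLp_phase s).toLp _)

/-- The energy density `f(E) = ⟨E|ρ|E⟩`, evaluated as `∑ₖ |⟨E|√ρ|bₖ⟩|²`; that is, the density of
the measure `B ↦ Tr[√ρ 1_B(H_W) √ρ] = Tr[ρ 1_B(H_W)]`. -/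
def energyDensity (ρ : Weight →L[ℂ] Weight) (E : ℝ) : ℝ≥0∞ :=
  ∑' k, ‖(opSqrt ρ (stdBasis Weight k) : Weight) E‖ₑ ^ 2

/-- The amplitude of `ψ` at the time state `|t⟩` with `⟨E|t⟩ = exp(i t E) / √(2π)`, namely
`⟨t|ψ⟩ = (2π)^(-1/2) ∫ exp(-i t E) ψ(E) dE`, in terms of the `L²` Fourier transform, whose
kernel is `exp(-2π i x E)`. -/
def timeAmplitude (ψ : Weight) (t : ℝ) : ℂ :=
  ((√(2 * Real.pi))⁻¹ : ℝ) * (𝓕 ψ : Weight) (t / (2 * Real.pi))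

/-- The time-state density `g(t) = ⟨t|ρ|t⟩`, evaluated as `∑ₖ |⟨t|√ρ|bₖ⟩|²`. -/
def timeDensity (ρ : Weight →L[ℂ] Weight) (t : ℝ) : ℝ≥0∞ :=
  ∑' k, ‖timeAmplitude (opSqrt ρ (stdBasis Weight k)) t‖ₑ ^ 2

/-- The standard deviation `σ_E` of the energy, with value `∞` if the energy distribution has no
finite second moment. -/
def energyStd (ρ : Weight →L[ℂ] Weight) : ℝ≥0∞ :=
  evariance (fun E : ℝ => E) (volume.withDensity (energyDensity ρ)) ^ (1 / 2 : ℝ)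

/-- The characteristic function `γ(ω) = ∫ g(t) exp(i ω t) dt` of the time-state distribution. -/
def dumping (ρ : Weight →L[ℂ] Weight) (ω : ℝ) : ℂ :=
  charFun (volume.withDensity (timeDensity ρ)) ω

/-! ### The composite of the system and the weight -/

variable {ι : Type*} [Fintype ι]

/-- The composite Hilbert space `ℂ^ι ⊗ L²(ℝ)`, as families `(ψᵢ)` standing for
`∑ᵢ |εᵢ⟩ ⊗ ψᵢ`, where `|εᵢ⟩` is the energy eigenbasis of the system. -/
abbrev Composite (ι : Type*) [Fintype ι] : Type _ := PiLp 2 (fun _ : ι => Weight)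

/-- The map `⟨εᵢ| ⊗ 1` from the composite space to the weight. -/
def comp (i : ι) : Composite ι →L[ℂ] Weight := PiLp.proj 2 (fun _ : ι => Weight) i

/-- The map `|εᵢ⟩ ⊗ 1` from the weight to the composite space. -/
def incl (i : ι) : Weight →L[ℂ] Composite ι := ContinuousLinearMap.adjoint (comp i)

/-- The operator `A ⊗ B`, where `A` is given by its matrix in the energy eigenbasis. -/
def tensor (A : Matrix ι ι ℂ) (B : Weight →L[ℂ] Weight) : Composite ι →L[ℂ] Composite ι :=
  ∑ i, ∑ j, A i j • (incl i ∘L B ∘L comp j)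

/-- The block-diagonal operator `∑ⱼ |εⱼ⟩⟨εⱼ| ⊗ B j`. -/
def blockDiag (B : ι → Weight →L[ℂ] Weight) : Composite ι →L[ℂ] Composite ι :=
  ∑ j, incl j ∘L B j ∘L comp j

/-- The partial trace over the system. -/
def trS (X : Composite ι →L[ℂ] Composite ι) : Weight →L[ℂ] Weight :=
  ∑ i, comp i ∘L X ∘L incl i

/-- The partial trace over the weight, as a matrix in the energy eigenbasis. -/
def trW (X : Composite ι →L[ℂ] Composite ι) : Matrix ι ι ℂ :=
  Matrix.of fun i j => tr (comp i ∘L X ∘L incl j)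

/-- The free evolution `exp(-i s (H_S + H_W))`, where `H_S = ∑ⱼ εⱼ |εⱼ⟩⟨εⱼ|`. -/
def freeEvolution (ε : ι → ℝ) (s : ℝ) : Composite ι →L[ℂ] Composite ι :=
  blockDiag fun j => Complex.exp (-(s * ε j : ℝ) * Complex.I) • weightEvolution s

/-- The operator `S = exp(-i H_S ⊗ Δ_W) = ∑ⱼ |εⱼ⟩⟨εⱼ| ⊗ exp(-i εⱼ Δ_W)`. -/
def shiftS (ε : ι → ℝ) : Composite ι →L[ℂ] Composite ι :=
  blockDiag fun j => displacement (ε j)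

/-- A work extraction protocol: a unitary operator with `[U, H_S + H_W] = 0` and `[U, Δ_W] = 0`.
Commuting with an unbounded self-adjoint operator means commuting with the unitary group that it
generates. -/
structure IsProtocol (ε : ι → ℝ) (U : Composite ι →L[ℂ] Composite ι) : Prop where
  unitary : U ∈ unitary (Composite ι →L[ℂ] Composite ι)
  energy_conserving : ∀ s : ℝ, Commute U (freeEvolution ε s)
  translation_invariant : ∀ a : ℝ, Commute U (blockDiag fun _ => displacement a)

/-- A density matrix of the system. -/
def IsDensityMatrix (ρS : Matrix ι ι ℂ) : Prop := ρS.PosSemidef ∧ ρS.trace = 1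

/-- The final state `Tr_S[U (ρ_S ⊗ ρ_W) U†]` of the weight. -/
def finalWeight (U : Composite ι →L[ℂ] Composite ι) (ρS : Matrix ι ι ℂ)
    (ρW : Weight →L[ℂ] Weight) : Weight →L[ℂ] Weight :=
  trS (U ∘L tensor ρS ρW ∘L ContinuousLinearMap.adjoint U)

/-- The control-marginal state `σ_S = Tr_W[S (ρ_S ⊗ ρ_W) S†]`. -/
def controlMarginal (ε : ι → ℝ) (ρS : Matrix ι ι ℂ) (ρW : Weight →L[ℂ] Weight) :
    Matrix ι ι ℂ :=
  trW (shiftS ε ∘L tensor ρS ρW ∘L ContinuousLinearMap.adjoint (shiftS ε))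

end QuantumWeight

end

/-! In the Fourier picture a displacement is a phase, so that `γ(ω) = Tr[ρ_W exp(i ω Δ_W)]`, with
`exp(i ω Δ_W)` the displacement by `-ω`. This identity gives the three claims.

* The block `(i, j)` of `S (ρ_S ⊗ ρ_W) S†` is `⟨εᵢ|ρ_S|εⱼ⟩ Γ_{εᵢ} ρ_W Γ_{εⱼ}†`, whose trace is
  `⟨εᵢ|ρ_S|εⱼ⟩ Tr[ρ_W Γ_{εᵢ - εⱼ}]`.
* A decomposition of `ρ_S` into pure states turns the protocol into a Kraus map on the weight. Since
  `U` commutes with displacements, the dual map fixes them, so `γ` is invariant, and with it the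
  distribution of which it is the characteristic function.
* By Cauchy–Schwarz `|γ(ω)|` is at most the overlap `∫ √f(E) √f(E + ω) dE` of the energy density
  with its translate. As `ω ≤ |E - m| + |E + ω - m|`, with `m` the mean energy, Cauchy–Schwarz again
  yields `ω |γ(ω)| ≤ 2 σ_E`, and `2 ≤ π`. By the invariance of `γ` the same bound holds for the
  final state. -/

namespace QuantumWeight

/-! ### Integrals of squares and translates -/

section Integrals

lemma lintegral_mul_le_sqrt_mul_sqrt {α : Type*} [MeasurableSpace α] {μ : Measure α}
    {f g : α → ℝ≥0∞} (hf : AEMeasurable f μ) (hg : AEMeasurable g μ) :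
    ∫⁻ x, f x * g x ∂μ ≤
      (∫⁻ x, f x ^ 2 ∂μ) ^ (1 / 2 : ℝ) * (∫⁻ x, g x ^ 2 ∂μ) ^ (1 / 2 : ℝ) := by
  simpa [ENNReal.rpow_two] using
    ENNReal.lintegral_mul_le_Lp_mul_Lq μ Real.HolderConjugate.two_two hf hg

lemma tsum_mul_le_sqrt_mul_sqrt {κ : Type*} (f g : κ → ℝ≥0∞) :
    ∑' k, f k * g k ≤ (∑' k, f k ^ 2) ^ (1 / 2 : ℝ) * (∑' k, g k ^ 2) ^ (1 / 2 : ℝ) := by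
  let _ : MeasurableSpace κ := ⊤
  simpa only [lintegral_count] using
    lintegral_mul_le_sqrt_mul_sqrt (μ := Measure.count) (f := f) (g := g)
      measurable_from_top.aemeasurable measurable_from_top.aemeasurable

lemma lintegral_sq_enorm_coeFn {α F : Type*} [MeasurableSpace α] {μ : Measure α}
    [NormedAddCommGroup F] (ψ : Lp F 2 μ) : ∫⁻ x, ‖ψ x‖ₑ ^ 2 ∂μ = ‖ψ‖ₑ ^ 2 := by
  have h := eLpNorm_nnreal_pow_eq_lintegral (μ := μ) (f := ψ) (p := 2) two_ne_zero
  rw [Lp.enorm_def]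
  simpa using h.symm

lemma enorm_mul_lintegral_mul_translate_le {F : Type*} [NormedAddCommGroup F]
    [MeasurableSpace F] [BorelSpace F] (μ : Measure F) [μ.IsAddRightInvariant]
    {s : F → ℝ≥0∞} (hs : Measurable s) (m v : F) :
    ‖v‖ₑ * ∫⁻ x, s x * s (x + v) ∂μ ≤
      2 * ((∫⁻ x, (‖x - m‖ₑ * s x) ^ 2 ∂μ) ^ (1 / 2 : ℝ) *
        (∫⁻ x, s x ^ 2 ∂μ) ^ (1 / 2 : ℝ)) := by
  set d : F → ℝ≥0∞ := fun x => ‖x - m‖ₑ * s x with hd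
  have d_measurable : Measurable d := by fun_prop
  set C := (∫⁻ x, d x ^ 2 ∂μ) ^ (1 / 2 : ℝ) * (∫⁻ x, s x ^ 2 ∂μ) ^ (1 / 2 : ℝ)
  have lintegral_left : ∫⁻ x, d x * s (x + v) ∂μ ≤ C := by
    refine (lintegral_mul_le_sqrt_mul_sqrt (by fun_prop) (by fun_prop)).trans_eq ?_
    rw [lintegral_add_right_eq_self (fun x => s x ^ 2) v]
  have lintegral_right : ∫⁻ x, d (x + v) * s x ∂μ ≤ C := by
    refine (lintegral_mul_le_sqrt_mul_sqrt (by fun_prop) (by fun_prop)).trans_eq ?_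
    rw [lintegral_add_right_eq_self (fun x => d x ^ 2) v]
  have enorm_le (x : F) : ‖v‖ₑ ≤ ‖x - m‖ₑ + ‖x + v - m‖ₑ := by
    calc ‖v‖ₑ = ‖(x + v - m) - (x - m)‖ₑ := by congr 1; abel
      _ ≤ ‖x + v - m‖ₑ + ‖x - m‖ₑ := enorm_sub_le
      _ = _ := add_comm _ _
  calc ‖v‖ₑ * ∫⁻ x, s x * s (x + v) ∂μ
    _ = ∫⁻ x, ‖v‖ₑ * (s x * s (x + v)) ∂μ := (lintegral_const_mul _ (by fun_prop)).symm
    _ ≤ ∫⁻ x, (‖x - m‖ₑ + ‖x + v - m‖ₑ) * (s x * s (x + v)) ∂μ := by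
        gcongr with x; exact enorm_le x
    _ = ∫⁻ x, (d x * s (x + v) + d (x + v) * s x) ∂μ := by congr with x; simp only [hd]; ring
    _ = ∫⁻ x, d x * s (x + v) ∂μ + ∫⁻ x, d (x + v) * s x ∂μ :=
        lintegral_add_left (by fun_prop) _
    _ ≤ C + C := add_le_add lintegral_left lintegral_right
    _ = 2 * C := (two_mul C).symm

lemma map_mul_left_withDensity {r : ℝ} (hr : r ≠ 0) {f : ℝ → ℝ≥0∞} (hf : Measurable f) :
    (volume.withDensity f).map (r * ·) =
      volume.withDensity fun t => ENNReal.ofReal |r⁻¹| * f (t / r) := by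
  ext s hs
  calc (volume.withDensity f).map (r * ·) s
    _ = ∫⁻ x in (r * ·) ⁻¹' s, f x := by
        rw [Measure.map_apply (by fun_prop) hs, withDensity_apply _ (measurable_const_mul r hs)]
    _ = ∫⁻ t in s, f (t / r) ∂(volume.map (r * ·)) := by
        rw [setLIntegral_map hs (by fun_prop) (by fun_prop)]
        simp only [mul_div_cancel_left₀ _ hr]
    _ = ∫⁻ t in s, ENNReal.ofReal |r⁻¹| * f (t / r) := by
        rw [Real.map_volume_mul_left hr, Measure.restrict_smul, lintegral_smul_measure,
          lintegral_const_mul _ (by fun_prop), smul_eq_mul]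
    _ = _ := (withDensity_apply _ hs).symm

lemma hasSum_charFun {κ F : Type*} [NormedAddCommGroup F] [InnerProductSpace ℝ F]
    [MeasurableSpace F] [OpensMeasurableSpace F] (μ : κ → Measure F)
    [IsFiniteMeasure (Measure.sum μ)] (ω : F) :
    HasSum (fun k => charFun (μ k) ω) (charFun (Measure.sum μ) ω) := by
  have continuous_exp : Continuous fun x : F => Complex.exp (⟪x, ω⟫_ℝ * Complex.I) := by fun_prop
  exact hasSum_integral_measure ((integrable_const (1 : ℝ)).mono'
    continuous_exp.aestronglyMeasurable
    (.of_forall fun x => (Complex.norm_exp_ofReal_mul_I _).le))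

end Integrals

/-! ### Density operators and Kraus maps -/

section HilbertSchmidt

open ContinuousLinearMap (adjoint adjoint_inner_left adjoint_inner_right)

lemma countable_of_orthonormal {κ 𝕜 H : Type*} [RCLike 𝕜] [NormedAddCommGroup H]
    [InnerProductSpace 𝕜 H] [TopologicalSpace.SeparableSpace H] {v : κ → H}
    (hv : Orthonormal 𝕜 v) : Countable κ := by
  refine Pairwise.countable_of_isOpen_disjoint (s := fun k => Metric.ball (v k) (1 / 2))
    (fun i j hij => Metric.ball_disjoint_ball ?_) (fun _ => Metric.isOpen_ball)
    fun _ => Metric.nonempty_ball.2 one_half_pos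
  have sq_norm_sub : ‖v i - v j‖ ^ 2 = 2 := by
    rw [@norm_sub_sq 𝕜, hv.1, hv.1, hv.2 hij]
    norm_num
  rw [dist_eq_norm]
  nlinarith [norm_nonneg (v i - v j)]

variable {κ κ' 𝕜 H K L : Type*} [RCLike 𝕜] [NormedAddCommGroup H] [InnerProductSpace 𝕜 H]
  [NormedAddCommGroup K] [InnerProductSpace 𝕜 K] [NormedAddCommGroup L] [InnerProductSpace 𝕜 L]

lemma hasSum_sq_norm_inner (b : HilbertBasis κ 𝕜 H) (v : H) :
    HasSum (fun k => ‖inner 𝕜 (b k) v‖ ^ 2) (‖v‖ ^ 2) := by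
  have h := RCLike.hasSum_re 𝕜 (b.hasSum_inner_mul_inner v v)
  rw [inner_self_eq_norm_sq] at h
  refine h.congr_fun fun k => ?_
  rw [← inner_conj_symm v, RCLike.conj_mul, ← RCLike.ofReal_pow, RCLike.ofReal_re]

/-- The Hilbert–Schmidt property `∑ₖ ‖X bₖ‖² < ∞`, evaluated in a given orthonormal basis `b`; it
does not depend on `b`. -/
def IsHilbertSchmidt (b : HilbertBasis κ 𝕜 H) (X : H →L[𝕜] K) : Prop :=
  Summable fun k => ‖X (b k)‖ ^ 2

lemma IsHilbertSchmidt.comp_left {b : HilbertBasis κ 𝕜 H} {X : H →L[𝕜] K}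
    (hX : IsHilbertSchmidt b X) (A : K →L[𝕜] L) : IsHilbertSchmidt b (A ∘L X) := by
  refine Summable.of_nonneg_of_le (fun _ => by positivity) (fun k => ?_) (hX.mul_left (‖A‖ ^ 2))
  rw [← mul_pow]
  gcongr
  exact A.le_opNorm _

lemma IsHilbertSchmidt.summable_sq_norm_inner {b : HilbertBasis κ 𝕜 H} {X : H →L[𝕜] K}
    (hX : IsHilbertSchmidt b X) (b' : HilbertBasis κ' 𝕜 K) :
    Summable fun p : κ × κ' => ‖inner 𝕜 (b' p.2) (X (b p.1))‖ ^ 2 := by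
  have row (k : κ) : HasSum (fun l => ‖inner 𝕜 (b' l) (X (b k))‖ ^ 2) (‖X (b k)‖ ^ 2) :=
    hasSum_sq_norm_inner b' (X (b k))
  refine (summable_prod_of_nonneg fun _ => sq_nonneg _).2 ⟨fun k => (row k).summable, ?_⟩
  simpa only [(row _).tsum_eq, IsHilbertSchmidt] using hX

/-- Cyclicity of the trace, `Tr[X† Y] = Tr[Y X†]`: both sides are the sum of the double series
`∑ₖₗ ⟨X bₖ, b'ₗ⟩⟨b'ₗ, Y bₖ⟩`. -/
lemma IsHilbertSchmidt.hasSum_inner_adjoint [CompleteSpace H] [CompleteSpace K]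
    {b : HilbertBasis κ 𝕜 H} {X Y : H →L[𝕜] K} (hX : IsHilbertSchmidt b X)
    (hY : IsHilbertSchmidt b Y) (b' : HilbertBasis κ' 𝕜 K) :
    HasSum (fun l => inner 𝕜 (adjoint Y (b' l)) (adjoint X (b' l)))
      (∑' k, inner 𝕜 (X (b k)) (Y (b k))) := by
  have summable_double : Summable fun p : κ × κ' =>
      inner 𝕜 (X (b p.1)) (b' p.2) * inner 𝕜 (b' p.2) (Y (b p.1)) := by
    refine .of_norm_bounded ((hX.summable_sq_norm_inner b').add (hY.summable_sq_norm_inner b'))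
      fun p => ?_
    rw [norm_mul, norm_inner_symm]
    nlinarith [two_mul_le_add_sq ‖inner 𝕜 (b' p.2) (X (b p.1))‖
        ‖inner 𝕜 (b' p.2) (Y (b p.1))‖, sq_nonneg ‖inner 𝕜 (b' p.2) (X (b p.1))‖,
      sq_nonneg ‖inner 𝕜 (b' p.2) (Y (b p.1))‖]
  have row (k : κ) : HasSum (fun l => inner 𝕜 (X (b k)) (b' l) * inner 𝕜 (b' l) (Y (b k)))
      (inner 𝕜 (X (b k)) (Y (b k))) := b'.hasSum_inner_mul_inner _ _
  have column (l : κ') : HasSum (fun k => inner 𝕜 (X (b k)) (b' l) * inner 𝕜 (b' l) (Y (b k)))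
      (inner 𝕜 (adjoint Y (b' l)) (adjoint X (b' l))) := by
    refine (b.hasSum_inner_mul_inner (adjoint Y (b' l)) (adjoint X (b' l))).congr_fun fun k => ?_
    rw [adjoint_inner_left, adjoint_inner_right, mul_comm]
  have double := summable_double.hasSum
  rw [← (double.prod_fiberwise row).tsum_eq] at double
  exact HasSum.prod_fiberwise ((Equiv.prodComm κ' κ).hasSum_iff.2 double) column

end HilbertSchmidt

section DensityOperator

open ContinuousLinearMap (adjoint adjoint_inner_left adjoint_inner_right adjoint_comp)

variable {κ H K : Type*} [NormedAddCommGroup H] [InnerProductSpace ℂ H] [CompleteSpace H]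
  [NormedAddCommGroup K] [InnerProductSpace ℂ K] [CompleteSpace K] {ρ : H →L[ℂ] H}

instance countable_basisIndex [TopologicalSpace.SeparableSpace H] : Countable (BasisIndex H) :=
  countable_of_orthonormal (stdBasis H).orthonormal

lemma tr_smul (c : ℂ) (A : H →L[ℂ] H) : tr (c • A) = c * tr A := by
  simp only [tr, smul_apply, inner_smul_right, tsum_mul_left]

lemma adjoint_opSqrt (ρ : H →L[ℂ] H) : adjoint (opSqrt ρ) = opSqrt ρ :=
  (IsSelfAdjoint.of_nonneg (CFC.sqrt_nonneg ρ)).adjoint_eq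

lemma opSqrt_comp_opSqrt (hρ : ρ.IsPositive) : opSqrt ρ ∘L opSqrt ρ = ρ :=
  CFC.sqrt_mul_sqrt_self ρ ((ContinuousLinearMap.nonneg_iff_isPositive ρ).2 hρ)

lemma inner_opSqrt_opSqrt (hρ : ρ.IsPositive) (v w : H) :
    ⟪opSqrt ρ v, opSqrt ρ w⟫_ℂ = ⟪v, ρ w⟫_ℂ := by
  rw [← adjoint_inner_right, adjoint_opSqrt, ← ContinuousLinearMap.comp_apply,
    opSqrt_comp_opSqrt hρ]

namespace IsDensityOperator

lemma hasSum_sq_norm_opSqrt (hρ : IsDensityOperator ρ) :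
    HasSum (fun k => ‖opSqrt ρ (stdBasis H k)‖ ^ 2) 1 := by
  refine (Complex.hasSum_re hρ.2).congr_fun fun k => ?_
  rw [← inner_opSqrt_opSqrt hρ.1, ← inner_self_eq_norm_sq (𝕜 := ℂ)]
  rfl

lemma isHilbertSchmidt_opSqrt (hρ : IsDensityOperator ρ) :
    IsHilbertSchmidt (stdBasis H) (opSqrt ρ) :=
  hρ.hasSum_sq_norm_opSqrt.summable

lemma tsum_sq_enorm_opSqrt (hρ : IsDensityOperator ρ) :
    ∑' k, ‖opSqrt ρ (stdBasis H k)‖ₑ ^ 2 = 1 := by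
  simp_rw [← ofReal_norm, ← ENNReal.ofReal_pow (norm_nonneg _)]
  rw [← ENNReal.ofReal_tsum_of_nonneg (fun _ => sq_nonneg _) hρ.isHilbertSchmidt_opSqrt,
    hρ.hasSum_sq_norm_opSqrt.tsum_eq, ENNReal.ofReal_one]

lemma hasSum_inner_comp_comp_adjoint_tsum (hρ : IsDensityOperator ρ) (A B : H →L[ℂ] K) :
    HasSum (fun l => ⟪stdBasis K l, (A ∘L ρ ∘L adjoint B) (stdBasis K l)⟫_ℂ)
      (∑' k, ⟪opSqrt ρ (stdBasis H k), (adjoint B ∘L A) (opSqrt ρ (stdBasis H k))⟫_ℂ) := by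
  have h := (hρ.isHilbertSchmidt_opSqrt.comp_left B).hasSum_inner_adjoint
    (hρ.isHilbertSchmidt_opSqrt.comp_left A) (stdBasis K)
  simpa only [adjoint_comp, adjoint_opSqrt, ContinuousLinearMap.comp_apply,
    inner_opSqrt_opSqrt hρ.1, adjoint_inner_left, adjoint_inner_right] using h

lemma hasSum_inner_comp_tsum (hρ : IsDensityOperator ρ) (A : H →L[ℂ] H) :
    HasSum (fun k => ⟪stdBasis H k, (A ∘L ρ) (stdBasis H k)⟫_ℂ)
      (∑' k, ⟪opSqrt ρ (stdBasis H k), A (opSqrt ρ (stdBasis H k))⟫_ℂ) := by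
  have adjoint_id : adjoint (.id ℂ H) = .id ℂ H := star_one (R := H →L[ℂ] H)
  simpa [adjoint_id] using hρ.hasSum_inner_comp_comp_adjoint_tsum A (.id ℂ H)

lemma tr_comp_eq_tsum (hρ : IsDensityOperator ρ) (A : H →L[ℂ] H) :
    tr (A ∘L ρ) = ∑' k, ⟪opSqrt ρ (stdBasis H k), A (opSqrt ρ (stdBasis H k))⟫_ℂ :=
  (hρ.hasSum_inner_comp_tsum A).tsum_eq

lemma hasSum_inner_comp (hρ : IsDensityOperator ρ) (A : H →L[ℂ] H) :
    HasSum (fun k => ⟪stdBasis H k, (A ∘L ρ) (stdBasis H k)⟫_ℂ) (tr (A ∘L ρ)) :=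
  (hρ.hasSum_inner_comp_tsum A).summable.hasSum

lemma hasSum_inner_comp_comp_adjoint (hρ : IsDensityOperator ρ) (A B : H →L[ℂ] K) :
    HasSum (fun l => ⟪stdBasis K l, (A ∘L ρ ∘L adjoint B) (stdBasis K l)⟫_ℂ)
      (tr ((adjoint B ∘L A) ∘L ρ)) := by
  rw [hρ.tr_comp_eq_tsum]
  exact hρ.hasSum_inner_comp_comp_adjoint_tsum A B

lemma tr_comp_comp_adjoint (hρ : IsDensityOperator ρ) (A B : H →L[ℂ] K) :
    tr (A ∘L ρ ∘L adjoint B) = tr ((adjoint B ∘L A) ∘L ρ) :=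
  (hρ.hasSum_inner_comp_comp_adjoint A B).tsum_eq

end IsDensityOperator

variable [Fintype κ]

/-- The operation `ρ ↦ ∑ᵢ Vᵢ ρ Vᵢ†` on states with Kraus operators `Vᵢ`. -/
noncomputable def krausMap (V : κ → H →L[ℂ] K) (ρ : H →L[ℂ] H) : K →L[ℂ] K :=
  ∑ i, V i ∘L ρ ∘L adjoint (V i)

/-- The Heisenberg dual `A ↦ ∑ᵢ Vᵢ† A Vᵢ` of `krausMap`, acting on observables. -/
noncomputable def krausDual (V : κ → H →L[ℂ] K) (A : K →L[ℂ] K) : H →L[ℂ] H :=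
  ∑ i, adjoint (V i) ∘L A ∘L V i

namespace IsDensityOperator

lemma hasSum_inner_comp_krausMap (hρ : IsDensityOperator ρ) (V : κ → H →L[ℂ] K)
    (A : K →L[ℂ] K) :
    HasSum (fun l => ⟪stdBasis K l, (A ∘L krausMap V ρ) (stdBasis K l)⟫_ℂ)
      (tr (krausDual V A ∘L ρ)) := by
  have tr_krausDual : tr (krausDual V A ∘L ρ) = ∑ i, tr ((adjoint (V i) ∘L A ∘L V i) ∘L ρ) := by
    refine ((hasSum_sum fun i _ => hρ.hasSum_inner_comp _).congr_fun fun k => ?_).tsum_eq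
    simp [krausDual]
  rw [tr_krausDual]
  refine (hasSum_sum fun i _ => hρ.hasSum_inner_comp_comp_adjoint (A ∘L V i) (V i)).congr_fun
    fun l => ?_
  simp [krausMap]

lemma tr_comp_krausMap (hρ : IsDensityOperator ρ) (V : κ → H →L[ℂ] K) (A : K →L[ℂ] K) :
    tr (A ∘L krausMap V ρ) = tr (krausDual V A ∘L ρ) :=
  (hρ.hasSum_inner_comp_krausMap V A).tsum_eq

protected lemma krausMap (hρ : IsDensityOperator ρ) {V : κ → H →L[ℂ] K}
    (hV : krausDual V (.id ℂ K) = .id ℂ H) : IsDensityOperator (krausMap V ρ) := by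
  refine ⟨ContinuousLinearMap.isPositive_sum _ fun i _ => hρ.1.conj_adjoint (V i), ?_⟩
  have tr_eq_one : tr ρ = 1 := hρ.2.tsum_eq
  simpa [hV, tr_eq_one] using hρ.hasSum_inner_comp_krausMap V (.id ℂ K)

end IsDensityOperator

end DensityOperator

/-! ### Displacements and time states -/

section TimeStates

open ContinuousLinearMap (adjoint)

open Real (pi)

instance : SecondCountableTopology Weight :=
  haveI : Fact ((2 : ℝ≥0∞) ≠ ∞) := ⟨ENNReal.ofNat_ne_top⟩
  inferInstance

lemma coeFn_displacement (a : ℝ) (ψ : Weight) :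
    displacement a ψ =ᵐ[volume] fun E => ψ (E - a) :=
  Lp.coeFn_compMeasurePreserving ψ (measurePreserving_sub_right volume a)

lemma coeFn_weightEvolution (s : ℝ) (ψ : Weight) :
    weightEvolution s ψ =ᵐ[volume] fun E => Complex.exp (-(s * E : ℝ) * Complex.I) * ψ E := by
  filter_upwards [(ContinuousLinearMap.mul ℂ ℂ).coeFn_holder (r := 2) ((memLp_phase s).toLp _) ψ,
    (memLp_phase s).coeFn_toLp] with E coeFn_holder coeFn_phase
  rw [coeFn_phase] at coeFn_holder
  exact coeFn_holder

lemma displacement_zero : displacement 0 = .id ℂ Weight := by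
  ext1 ψ
  refine Lp.ext ?_
  filter_upwards [coeFn_displacement 0 ψ] with E h
  rw [h, sub_zero, ContinuousLinearMap.id_apply]

lemma displacement_comp_displacement (a b : ℝ) :
    displacement a ∘L displacement b = displacement (a + b) := by
  ext1 ψ
  refine Lp.ext ?_
  filter_upwards [coeFn_displacement a (displacement b ψ), coeFn_displacement (a + b) ψ,
    (measurePreserving_sub_right volume a).quasiMeasurePreserving.ae_eq_comp
      (coeFn_displacement b ψ)] with E displacement_a displacement_add displacement_b
  rw [ContinuousLinearMap.comp_apply, displacement_a, displacement_add, ← sub_sub]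
  exact displacement_b

lemma adjoint_displacement (a : ℝ) : adjoint (displacement a) = displacement (-a) := by
  have isometry : adjoint (displacement a) ∘L displacement a = .id ℂ Weight :=
    (ContinuousLinearMap.norm_map_iff_adjoint_comp_self _).1
      (Lp.compMeasurePreservingₗᵢ ℂ _ _).norm_map
  calc adjoint (displacement a)
    _ = adjoint (displacement a) ∘L displacement a ∘L displacement (-a) := by
        rw [displacement_comp_displacement, add_neg_cancel, displacement_zero,
          ContinuousLinearMap.comp_id]
    _ = displacement (-a) := by
        rw [← ContinuousLinearMap.comp_assoc, isometry, ContinuousLinearMap.id_comp]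

lemma displacement_toLp (a : ℝ) (f : SchwartzMap ℝ ℂ) :
    displacement a (f.toLp 2) = (f.compSubConstCLM ℂ a).toLp 2 := by
  refine Lp.ext ?_
  filter_upwards [coeFn_displacement a (f.toLp 2), (f.compSubConstCLM ℂ a).coeFn_toLp 2 volume,
    (measurePreserving_sub_right volume a).quasiMeasurePreserving.ae_eq_comp
      (f.coeFn_toLp 2 volume)] with E coeFn_left coeFn_right coeFn_f
  rw [coeFn_left, coeFn_right]
  exact coeFn_f

lemma fourier_comp_sub_right (f : ℝ → ℂ) (a x : ℝ) :
    𝓕 (fun E => f (E - a)) x =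
      Complex.exp (-(2 * pi * a * x : ℝ) * Complex.I) * 𝓕 f x := by
  have h := congr_fun (Fourier.fourierIntegral_comp_add_right Real.fourierChar volume f (-a)) x
  simp only [Fourier.fourierIntegral_def, Function.comp_def, ← sub_eq_add_neg] at h
  rw [Real.fourier_real_eq, Real.fourier_real_eq, h, Circle.smul_def, Real.fourierChar_apply,
    smul_eq_mul]
  congr 3
  push_cast
  ring

lemma fourier_displacement (a : ℝ) (ψ : Weight) :
    (𝓕 (displacement a ψ) : Weight) = weightEvolution (2 * pi * a) (𝓕 ψ) := by
  have continuous_fourier : Continuous fun φ : Weight => (𝓕 φ : Weight) :=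
    (Lp.fourierTransformₗᵢ ℝ ℂ).continuous
  refine (SchwartzMap.denseRange_toLpCLM (E := ℝ) (F := ℂ) (μ := volume) (p := 2)
    ENNReal.ofNat_ne_top).induction_on ψ
    (isClosed_eq (continuous_fourier.comp (displacement a).continuous)
      ((weightEvolution (2 * pi * a)).continuous.comp continuous_fourier)) fun f => ?_
  change (𝓕 (displacement a (f.toLp 2)) : Weight) = weightEvolution _ (𝓕 (f.toLp 2))
  rw [displacement_toLp, SchwartzMap.toLp_fourier_eq, SchwartzMap.toLp_fourier_eq]
  refine Lp.ext ?_
  filter_upwards [coeFn_weightEvolution (2 * pi * a) ((𝓕 f).toLp 2),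
    (𝓕 f).coeFn_toLp 2 volume, (𝓕 (f.compSubConstCLM ℂ a)).coeFn_toLp 2 volume]
    with x coeFn_evolution coeFn_f coeFn_translate
  rw [coeFn_evolution, coeFn_f, coeFn_translate, SchwartzMap.fourier_coe, SchwartzMap.fourier_coe]
  exact fourier_comp_sub_right f a x

lemma charFun_withDensity_sq_enorm (φ : Weight) (ω : ℝ) :
    charFun (volume.withDensity fun x => ‖φ x‖ₑ ^ 2) ω = ⟪φ, weightEvolution (-ω) φ⟫_ℂ := by
  rw [charFun_apply_real, L2.inner_def, integral_withDensity_eq_integral_toReal_smul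
    ((Lp.stronglyMeasurable φ).enorm.pow_const 2)
    (.of_forall fun _ => ENNReal.pow_lt_top enorm_lt_top)]
  refine integral_congr_ae ?_
  filter_upwards [coeFn_weightEvolution (-ω) φ] with x hx
  rw [hx, RCLike.inner_apply, mul_assoc (Complex.exp _), RCLike.mul_conj, ENNReal.toReal_pow,
    toReal_enorm, Complex.real_smul, mul_comm]
  simp

lemma measurable_timeAmplitude (ψ : Weight) : Measurable (timeAmplitude ψ) := by
  have := (Lp.stronglyMeasurable (𝓕 ψ : Weight)).measurable
  unfold timeAmplitude
  fun_prop

lemma withDensity_sq_enorm_timeAmplitude (ψ : Weight) :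
    volume.withDensity (fun t => ‖timeAmplitude ψ t‖ₑ ^ 2) =
      (volume.withDensity fun x => ‖(𝓕 ψ : Weight) x‖ₑ ^ 2).map (2 * pi * ·) := by
  have sq_enorm_inv_sqrt : ‖(((√(2 * pi))⁻¹ : ℝ) : ℂ)‖ₑ ^ 2 = ENNReal.ofReal |(2 * pi)⁻¹| := by
    rw [← ofReal_norm, ← ENNReal.ofReal_pow (norm_nonneg _), Complex.norm_real, Real.norm_eq_abs,
      sq_abs, inv_pow, Real.sq_sqrt (by positivity), abs_of_pos (by positivity)]
  rw [map_mul_left_withDensity (by positivity)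
    ((Lp.stronglyMeasurable _).measurable.enorm.pow_const 2)]
  simp only [timeAmplitude, enorm_mul, mul_pow, sq_enorm_inv_sqrt]

lemma lintegral_sq_enorm_timeAmplitude (ψ : Weight) :
    ∫⁻ t, ‖timeAmplitude ψ t‖ₑ ^ 2 = ‖ψ‖ₑ ^ 2 := by
  have h := congr_arg (fun μ : Measure ℝ => μ .univ) (withDensity_sq_enorm_timeAmplitude ψ)
  simp only [Measure.map_apply (measurable_const_mul (2 * pi)) .univ, Set.preimage_univ,
    withDensity_apply _ .univ, Measure.restrict_univ] at h
  rw [h, lintegral_sq_enorm_coeFn, ← ofReal_norm, Lp.norm_fourier_eq, ofReal_norm]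

lemma charFun_sq_enorm_timeAmplitude (ψ : Weight) (ω : ℝ) :
    charFun (volume.withDensity fun t => ‖timeAmplitude ψ t‖ₑ ^ 2) ω =
      ⟪ψ, displacement (-ω) ψ⟫_ℂ := by
  rw [withDensity_sq_enorm_timeAmplitude, charFun_map_mul, charFun_withDensity_sq_enorm,
    ← mul_neg, ← fourier_displacement, Lp.inner_fourier_eq]

lemma measurable_timeDensity (ρ : Weight →L[ℂ] Weight) : Measurable (timeDensity ρ) :=
  Measurable.tsum fun _ => (measurable_timeAmplitude _).enorm.pow_const 2

lemma withDensity_timeDensity (ρ : Weight →L[ℂ] Weight) :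
    volume.withDensity (timeDensity ρ) = Measure.sum fun k =>
      volume.withDensity fun t => ‖timeAmplitude (opSqrt ρ (stdBasis Weight k)) t‖ₑ ^ 2 := by
  rw [← withDensity_tsum fun _ => (measurable_timeAmplitude _).enorm.pow_const 2]
  congr 1
  ext t
  rw [timeDensity, tsum_apply (Pi.summable.2 fun _ => ENNReal.summable)]

namespace IsDensityOperator

variable {ρ ρ' : Weight →L[ℂ] Weight}

lemma lintegral_timeDensity (hρ : IsDensityOperator ρ) : ∫⁻ t, timeDensity ρ t = 1 := by
  unfold timeDensity
  rw [lintegral_tsum fun k => ((measurable_timeAmplitude _).enorm.pow_const 2).aemeasurable]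
  simp only [lintegral_sq_enorm_timeAmplitude, hρ.tsum_sq_enorm_opSqrt]

lemma isProbabilityMeasure_timeDensity (hρ : IsDensityOperator ρ) :
    IsProbabilityMeasure (volume.withDensity (timeDensity ρ)) :=
  ⟨by rw [withDensity_apply _ .univ, Measure.restrict_univ, hρ.lintegral_timeDensity]⟩

lemma dumping_eq_tsum (hρ : IsDensityOperator ρ) (ω : ℝ) :
    dumping ρ ω = ∑' k, ⟪opSqrt ρ (stdBasis Weight k),
      displacement (-ω) (opSqrt ρ (stdBasis Weight k))⟫_ℂ := by
  have isProbabilityMeasure_sum := hρ.isProbabilityMeasure_timeDensity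
  rw [withDensity_timeDensity] at isProbabilityMeasure_sum
  rw [dumping, withDensity_timeDensity, ← (hasSum_charFun _ ω).tsum_eq]
  simp only [charFun_sq_enorm_timeAmplitude]

lemma dumping_eq_tr (hρ : IsDensityOperator ρ) (ω : ℝ) :
    dumping ρ ω = tr (displacement (-ω) ∘L ρ) := by
  rw [hρ.dumping_eq_tsum, hρ.tr_comp_eq_tsum]

lemma timeDensity_ae_eq_of_dumping_eq (hρ : IsDensityOperator ρ) (hρ' : IsDensityOperator ρ')
    (h : dumping ρ = dumping ρ') : timeDensity ρ =ᵐ[volume] timeDensity ρ' := by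
  have := hρ.isProbabilityMeasure_timeDensity
  have := hρ'.isProbabilityMeasure_timeDensity
  refine (withDensity_eq_iff (measurable_timeDensity ρ).aemeasurable
    (measurable_timeDensity ρ').aemeasurable ?_).1 (Measure.ext_of_charFun h)
  rw [hρ.lintegral_timeDensity]
  exact ENNReal.one_ne_top

end IsDensityOperator

end TimeStates

/-! ### The uncertainty relation -/

section Uncertainty

lemma measurable_energyDensity (ρ : Weight →L[ℂ] Weight) : Measurable (energyDensity ρ) :=
  Measurable.tsum fun _ => (Lp.stronglyMeasurable _).measurable.enorm.pow_const 2

lemma enorm_inner_displacement_le (ψ : Weight) (ω : ℝ) :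
    ‖⟪ψ, displacement (-ω) ψ⟫_ℂ‖ₑ ≤ ∫⁻ x, ‖ψ x‖ₑ * ‖ψ (x + ω)‖ₑ := by
  rw [L2.inner_def]
  refine (enorm_integral_le_lintegral_enorm _).trans (lintegral_mono_ae ?_)
  filter_upwards [coeFn_displacement (-ω) ψ] with x hx
  rw [hx, sub_neg_eq_add, RCLike.inner_apply, enorm_mul, mul_comm, RCLike.enorm_conj]

lemma energyStd_eq_lintegral_rpow (ρ : Weight →L[ℂ] Weight) :
    energyStd ρ = (∫⁻ x, ‖x - ∫ E, E ∂(volume.withDensity (energyDensity ρ))‖ₑ ^ 2 *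
      energyDensity ρ x) ^ (1 / 2 : ℝ) := by
  rw [energyStd, evariance, lintegral_withDensity_eq_lintegral_mul _ (measurable_energyDensity ρ)
    (by fun_prop)]
  simp only [Pi.mul_apply, mul_comm]

namespace IsDensityOperator

variable {ρ : Weight →L[ℂ] Weight}

lemma lintegral_energyDensity (hρ : IsDensityOperator ρ) : ∫⁻ E, energyDensity ρ E = 1 := by
  unfold energyDensity
  rw [lintegral_tsum fun _ =>
    ((Lp.stronglyMeasurable _).measurable.enorm.pow_const 2).aemeasurable]
  simp only [lintegral_sq_enorm_coeFn, hρ.tsum_sq_enorm_opSqrt]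

lemma enorm_dumping_le (hρ : IsDensityOperator ρ) (ω : ℝ) :
    ‖dumping ρ ω‖ₑ ≤
      ∫⁻ x, energyDensity ρ x ^ (1 / 2 : ℝ) * energyDensity ρ (x + ω) ^ (1 / 2 : ℝ) := by
  set ψ : BasisIndex Weight → Weight := fun k => opSqrt ρ (stdBasis Weight k)
  have measurable_coeFn (k) : Measurable (ψ k) := (Lp.stronglyMeasurable _).measurable
  calc ‖dumping ρ ω‖ₑ
    _ = ‖∑' k, ⟪ψ k, displacement (-ω) (ψ k)⟫_ℂ‖ₑ := by rw [hρ.dumping_eq_tsum]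
    _ ≤ ∑' k, ‖⟪ψ k, displacement (-ω) (ψ k)⟫_ℂ‖ₑ := enorm_tsum_le_tsum_enorm
    _ ≤ ∑' k, ∫⁻ x, ‖ψ k x‖ₑ * ‖ψ k (x + ω)‖ₑ :=
        ENNReal.tsum_le_tsum fun k => enorm_inner_displacement_le (ψ k) ω
    _ = ∫⁻ x, ∑' k, ‖ψ k x‖ₑ * ‖ψ k (x + ω)‖ₑ := (lintegral_tsum fun k => by fun_prop).symm
    _ ≤ _ := lintegral_mono fun x => tsum_mul_le_sqrt_mul_sqrt _ _

theorem enorm_mul_enorm_dumping_le (hρ : IsDensityOperator ρ) (ω : ℝ) :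
    ‖ω‖ₑ * ‖dumping ρ ω‖ₑ ≤ 2 * energyStd ρ := by
  have sq_sqrt (y : ℝ≥0∞) : (y ^ (1 / 2 : ℝ)) ^ 2 = y := by
    rw [← ENNReal.rpow_natCast, ← ENNReal.rpow_mul]
    simp
  have overlap_le := enorm_mul_lintegral_mul_translate_le volume
    ((measurable_energyDensity ρ).pow_const (1 / 2 : ℝ))
    (∫ E, E ∂(volume.withDensity (energyDensity ρ))) ω
  simp only [mul_pow, sq_sqrt, hρ.lintegral_energyDensity, ENNReal.one_rpow, mul_one,
    ← energyStd_eq_lintegral_rpow] at overlap_le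
  exact (mul_le_mul_right (hρ.enorm_dumping_le ω) _).trans overlap_le

end IsDensityOperator

lemma ofReal_one_div_pi_mul_iSup_le {γ : ℝ → ℂ} {σ : ℝ≥0∞}
    (h : ∀ ω, ‖ω‖ₑ * ‖γ ω‖ₑ ≤ 2 * σ) :
    ENNReal.ofReal (1 / Real.pi) * (⨆ ω ∈ Set.Ioi (0 : ℝ), ENNReal.ofReal (ω * ‖γ ω‖)) ≤ σ := by
  have iSup_le : ⨆ ω ∈ Set.Ioi (0 : ℝ), ENNReal.ofReal (ω * ‖γ ω‖) ≤ 2 * σ := by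
    refine iSup₂_le fun ω hω => ?_
    rw [ENNReal.ofReal_mul (le_of_lt hω), ofReal_norm, ← Real.enorm_of_nonneg (le_of_lt hω)]
    exact h ω
  have one_div_pi_mul_two_le : ENNReal.ofReal (1 / Real.pi) * 2 ≤ 1 := by
    rw [← ENNReal.ofReal_ofNat 2, ← ENNReal.ofReal_mul (by positivity), ENNReal.ofReal_le_one,
      div_mul_eq_mul_div, one_mul, div_le_one Real.pi_pos]
    exact Real.two_le_pi
  calc _ ≤ ENNReal.ofReal (1 / Real.pi) * (2 * σ) := by gcongr
    _ = ENNReal.ofReal (1 / Real.pi) * 2 * σ := (mul_assoc _ _ _).symm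
    _ ≤ 1 * σ := by gcongr
    _ = σ := one_mul σ

end Uncertainty

/-! ### The reduced dynamics of the weight -/

section Composite

open ContinuousLinearMap (adjoint adjoint_inner_left adjoint_comp adjoint_adjoint)

variable {ι : Type*} [Fintype ι]

lemma incl_eq_single [DecidableEq ι] (i : ι) (w : Weight) :
    incl i w = WithLp.toLp 2 (Pi.single i w) := by
  refine ext_inner_right ℂ fun v => ?_
  rw [incl, adjoint_inner_left, PiLp.inner_apply, Finset.sum_eq_single i]
  · simp [comp]
  · intro j _ hj
    simp [hj]
  · simp

lemma comp_incl [DecidableEq ι] (i j : ι) (w : Weight) :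
    comp i (incl j w) = if i = j then w else 0 := by
  rw [incl_eq_single]
  simp [comp]

lemma comp_comp_blockDiag (B : ι → Weight →L[ℂ] Weight) (i : ι) :
    comp i ∘L blockDiag B = B i ∘L comp i := by
  classical
  ext1 v
  simp [blockDiag, comp_incl]

lemma comp_comp_tensor_comp_incl (A : Matrix ι ι ℂ) (B : Weight →L[ℂ] Weight) (i j : ι) :
    comp i ∘L tensor A B ∘L incl j = A i j • B := by
  classical
  ext1 v
  simp [tensor, comp_incl, apply_ite B]

lemma tensor_sum {κ : Type*} (s : Finset κ) (A : κ → Matrix ι ι ℂ) (B : Weight →L[ℂ] Weight) :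
    tensor (∑ k ∈ s, A k) B = ∑ k ∈ s, tensor (A k) B := by
  ext1 ψ
  simp only [tensor, Matrix.sum_apply, sum_apply, smul_apply, Finset.sum_smul]
  simp only [Finset.sum_comm (s := s)]

/-- The map `|v⟩ ⊗ 1` from the weight to the composite space, for a vector `v` of the system given
by its coordinates in the energy eigenbasis. -/
noncomputable def ketTensor (v : ι → ℂ) : Weight →L[ℂ] Composite ι := ∑ i, v i • incl i

lemma adjoint_ketTensor (v : ι → ℂ) : adjoint (ketTensor v) = ∑ i, star (v i) • comp i := by
  simp only [ketTensor, map_sum, LinearIsometryEquiv.map_smulₛₗ, incl, adjoint_adjoint,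
    starRingEnd_apply]

lemma tensor_vecMulVec (v w : ι → ℂ) (B : Weight →L[ℂ] Weight) :
    tensor (Matrix.vecMulVec v (star w)) B = ketTensor v ∘L B ∘L adjoint (ketTensor w) := by
  ext1 ψ
  rw [adjoint_ketTensor, tensor, Finset.sum_comm]
  simp [ketTensor, Matrix.vecMulVec_apply, Finset.smul_sum, smul_smul, mul_comm]

lemma adjoint_ketTensor_comp_blockDiag_comp_ketTensor (v w : ι → ℂ) (A : Weight →L[ℂ] Weight) :
    adjoint (ketTensor w) ∘L blockDiag (fun _ => A) ∘L ketTensor v = (star w ⬝ᵥ v) • A := by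
  classical
  ext1 ψ
  rw [adjoint_ketTensor]
  simp [blockDiag, ketTensor, comp_incl, dotProduct, Finset.sum_smul, smul_smul, apply_ite A,
    mul_comm]

/-- The Kraus operator `(⟨εᵢ| ⊗ 1) U (|v⟩ ⊗ 1)` of the operation which `U` induces on the weight
when the system starts in the pure state `v` and ends in `|εᵢ⟩`. -/
noncomputable def krausOp (U : Composite ι →L[ℂ] Composite ι) (v : ι → ℂ) (i : ι) :
    Weight →L[ℂ] Weight :=
  comp i ∘L U ∘L ketTensor v

variable {κ : Type*} [Fintype κ] {U : Composite ι →L[ℂ] Composite ι}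

lemma finalWeight_sum_vecMulVec (U : Composite ι →L[ℂ] Composite ι) (v : κ → ι → ℂ)
    (ρ : Weight →L[ℂ] Weight) :
    finalWeight U (∑ k, Matrix.vecMulVec (v k) (star (v k))) ρ =
      krausMap (fun p : κ × ι => krausOp U (v p.1) p.2) ρ := by
  rw [finalWeight, tensor_sum, trS, krausMap, Fintype.sum_prod_type_right]
  refine Finset.sum_congr rfl fun i _ => ?_
  ext1 ψ
  simp [tensor_vecMulVec, krausOp, adjoint_comp, incl]

lemma krausDual_krausOp (hU : star U * U = 1) (v : κ → ι → ℂ) {A : Weight →L[ℂ] Weight}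
    (hA : Commute U (blockDiag fun _ => A)) :
    krausDual (fun p : κ × ι => krausOp U (v p.1) p.2) A =
      (∑ k, Matrix.vecMulVec (v k) (star (v k))).trace • A := by
  have heisenberg : adjoint U ∘L blockDiag (fun _ => A) ∘L U = blockDiag fun _ => A := by
    change star U * (blockDiag (fun _ => A) * U) = _
    rw [← hA.eq, ← mul_assoc, hU, one_mul]
  have sum_krausOp (k : κ) : ∑ i, adjoint (krausOp U (v k) i) ∘L A ∘L krausOp U (v k) i =
      (star (v k) ⬝ᵥ v k) • A := by
    calc ∑ i, adjoint (krausOp U (v k) i) ∘L A ∘L krausOp U (v k) i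
      _ = adjoint (ketTensor (v k)) ∘L (adjoint U ∘L blockDiag (fun _ => A) ∘L U) ∘L
            ketTensor (v k) := by
          ext1 ψ
          simp [krausOp, adjoint_comp, blockDiag, incl]
      _ = (star (v k) ⬝ᵥ v k) • A := by
          rw [heisenberg, adjoint_ketTensor_comp_blockDiag_comp_ketTensor]
  rw [krausDual, Fintype.sum_prod_type]
  simp only [sum_krausOp, ← Finset.sum_smul, Matrix.trace_sum, Matrix.trace_vecMulVec,
    dotProduct_comm]

variable {ρS : Matrix ι ι ℂ} {ρW : Weight →L[ℂ] Weight}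

lemma exists_finalWeight_eq_krausMap (hρS : IsDensityMatrix ρS) (hU : star U * U = 1) :
    ∃ (m : ℕ) (V : Fin m × ι → Weight →L[ℂ] Weight),
      (∀ ρW, finalWeight U ρS ρW = krausMap V ρW) ∧
      ∀ A, Commute U (blockDiag fun _ => A) → krausDual V A = A := by
  obtain ⟨m, v, rfl⟩ := Matrix.posSemidef_iff_eq_sum_vecMulVec.1 hρS.1
  refine ⟨m, _, finalWeight_sum_vecMulVec U v, fun A hA => ?_⟩
  rw [krausDual_krausOp hU v hA, hρS.2, one_smul]

lemma isDensityOperator_finalWeight (hρS : IsDensityMatrix ρS) (hρW : IsDensityOperator ρW)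
    (hU : star U * U = 1) : IsDensityOperator (finalWeight U ρS ρW) := by
  obtain ⟨m, V, finalWeight_eq, krausDual_eq⟩ := exists_finalWeight_eq_krausMap hρS hU
  have blockDiag_id : blockDiag (fun _ : ι => .id ℂ Weight) = 1 := by
    ext1 ψ
    exact PiLp.ext fun i => DFunLike.congr_fun (comp_comp_blockDiag _ i) ψ
  rw [finalWeight_eq]
  exact hρW.krausMap (krausDual_eq _ (blockDiag_id ▸ Commute.one_right U))

lemma dumping_finalWeight (hρS : IsDensityMatrix ρS) (hρW : IsDensityOperator ρW)
    (hU : star U * U = 1) (hUD : ∀ a, Commute U (blockDiag fun _ => displacement a)) :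
    dumping (finalWeight U ρS ρW) = dumping ρW := by
  obtain ⟨m, V, finalWeight_eq, krausDual_eq⟩ := exists_finalWeight_eq_krausMap hρS hU
  ext ω
  rw [(isDensityOperator_finalWeight hρS hρW hU).dumping_eq_tr, finalWeight_eq,
    hρW.tr_comp_krausMap, krausDual_eq _ (hUD (-ω)), hρW.dumping_eq_tr]

lemma timeDensity_finalWeight (hρS : IsDensityMatrix ρS) (hρW : IsDensityOperator ρW)
    (hU : star U * U = 1) (hUD : ∀ a, Commute U (blockDiag fun _ => displacement a)) :
    timeDensity (finalWeight U ρS ρW) =ᵐ[volume] timeDensity ρW :=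
  (isDensityOperator_finalWeight hρS hρW hU).timeDensity_ae_eq_of_dumping_eq hρW
    (dumping_finalWeight hρS hρW hU hUD)

lemma controlMarginal_apply (ε : ι → ℝ) (ρS : Matrix ι ι ℂ) (hρW : IsDensityOperator ρW)
    (i j : ι) : controlMarginal ε ρS ρW i j = dumping ρW (ε j - ε i) * ρS i j := by
  have block : comp i ∘L (shiftS ε ∘L tensor ρS ρW ∘L adjoint (shiftS ε)) ∘L incl j =
      ρS i j • (displacement (ε i) ∘L ρW ∘L adjoint (displacement (ε j))) := by
    calc _ = (comp i ∘L shiftS ε) ∘L tensor ρS ρW ∘L adjoint (comp j ∘L shiftS ε) := by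
          rw [adjoint_comp]; rfl
      _ = displacement (ε i) ∘L (comp i ∘L tensor ρS ρW ∘L incl j) ∘L
            adjoint (displacement (ε j)) := by
          rw [shiftS, comp_comp_blockDiag, comp_comp_blockDiag, adjoint_comp]; rfl
      _ = _ := by
          rw [comp_comp_tensor_comp_incl]
          ext1 v
          simp
  rw [controlMarginal, trW, Matrix.of_apply, block, tr_smul, hρW.tr_comp_comp_adjoint,
    adjoint_displacement, displacement_comp_displacement, hρW.dumping_eq_tr, neg_sub,
    neg_add_eq_sub, mul_comm]

end Composite

end QuantumWeight

open QuantumWeight in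
theorem theorem2_general {ι : Type*} [Fintype ι] (ε : ι → ℝ)
    {ρS : Matrix ι ι ℂ} (hρS : IsDensityMatrix ρS)
    {ρW : Weight →L[ℂ] Weight} (hρW : IsDensityOperator ρW)
    {U : Composite ι →L[ℂ] Composite ι} (hU : star U * U = 1)
    (hUD : ∀ a, Commute U (blockDiag fun _ => displacement a)) :
    (∀ i j, controlMarginal ε ρS ρW i j = dumping ρW (ε j - ε i) * ρS i j) ∧
    timeDensity (finalWeight U ρS ρW) =ᵐ[volume] timeDensity ρW ∧
    (∀ ω, ‖ω‖ₑ * ‖dumping ρW ω‖ₑ ≤ 2 * energyStd ρW) ∧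
    ∀ ω, ‖ω‖ₑ * ‖dumping ρW ω‖ₑ ≤ 2 * energyStd (finalWeight U ρS ρW) := by
  refine ⟨controlMarginal_apply ε ρS hρW, timeDensity_finalWeight hρS hρW hU hUD,
    hρW.enorm_mul_enorm_dumping_le, ?_⟩
  rw [← dumping_finalWeight hρS hρW hU hUD]
  exact (isDensityOperator_finalWeight hρS hρW hU).enorm_mul_enorm_dumping_le

theorem theorem2 {ι : Type*} [Fintype ι] (ε : ι → ℝ)
    (ρS : Matrix ι ι ℂ) (hρS : QuantumWeight.IsDensityMatrix ρS)
    (ρW : QuantumWeight.Weight →L[ℂ] QuantumWeight.Weight)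
    (hρW : QuantumWeight.IsDensityOperator ρW)
    (U : QuantumWeight.Composite ι →L[ℂ] QuantumWeight.Composite ι)
    (hU : QuantumWeight.IsProtocol ε U) :
    -- `γ` is the factor by which the map to the control-marginal state damps the coherences
    (∀ i j, QuantumWeight.controlMarginal ε ρS ρW i j =
      QuantumWeight.dumping ρW (ε j - ε i) * ρS i j) ∧
    -- the time-state distribution is invariant under the protocol
    QuantumWeight.timeDensity (QuantumWeight.finalWeight U ρS ρW) =ᵐ[volume]
      QuantumWeight.timeDensity ρW ∧
    -- the bound for the initial standard deviation of the energy
    ENNReal.ofReal (1 / Real.pi) *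
        (⨆ ω ∈ Set.Ioi (0 : ℝ), ENNReal.ofReal (ω * ‖QuantumWeight.dumping ρW ω‖)) ≤
      QuantumWeight.energyStd ρW ∧
    -- the bound for the final standard deviation of the energy
    ENNReal.ofReal (1 / Real.pi) *
        (⨆ ω ∈ Set.Ioi (0 : ℝ), ENNReal.ofReal (ω * ‖QuantumWeight.dumping ρW ω‖)) ≤
      QuantumWeight.energyStd (QuantumWeight.finalWeight U ρS ρW) := by
  obtain ⟨marginal, invariant, initial, final⟩ :=
    theorem2_general ε hρS hρW hU.unitary.1 hU.translation_invariant
  exact ⟨marginal, invariant, QuantumWeight.ofReal_one_div_pi_mul_iSup_le initial,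
    QuantumWeight.ofReal_one_div_pi_mul_iSup_le final⟩
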